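/- **Setting.** A multigraph $G=(\mathcal V,\mathcal E)$ has a finite set $\mathcal V$ of at least two nodes and undirected simple edges, self-loops being allowed; write $i - j$ if $i,j$ are neighbors, $\mathcal E(U)$ for the set of neighbors of the elements of $U\subset\mathcal V$, and, for a measure $\mu$ on $\mathcal V$ with full support, $\bar\mu=\mu/\mu(\mathcal V)$. *General matching model $(G,\Phi,\bar\mu)$.* Items arrive one by one, with IID classes of law $\bar\mu$. The state $W_n$ is the word of the classes of the stored items, in order of arrival; no two stored items are compatible (that is, of neighboring classes). If an incoming item finds compatible stored items, it is matched with one of them and both leave; otherwise it is stored. The admissible policy $\Phi$ chooses the match as a function of the stored word, the class of the incoming item and an independent random draw. The model is stable if the Markov chain $(W_n)$ is positive recurrent; if $\Pi$ is then its stationary distribution, the asymptotic matching rates are $$\Theta^{\Phi,\bar\mu}[i,j]=\bar\mu(i)\,\Pi(A_{i\to j})+\mathbf 1_{\{i\ne j\}}\,\bar\mu(j)\,\Pi(A_{j\to i}),\qquad i,j\in\mathcal V,$$ where $\Pi(A_{i\to j})$ is the probability that, in a state of law $\Pi$, an incoming $i$-item is matched with a stored $j$-item. Let $\mathcal N(G)$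 be the set of measures $\mu$ with full support such that $\mu(U)<\mu(\mathcal E(U))$ for all $U\subset\mathcal V$ with $U\ne\emptyset,\mathcal V$. *Extended bipartite matching model $(G,\Phi,\tilde\mu)$*, for $G$ bipartite with bipartition $\mathcal V_1\cup\mathcal V_2$. Items arrive in couples $(i,j)\in\mathcal V_1\times\mathcal V_2$, IID of law $\tilde\mu$ with full support on $\mathcal V_1\times\mathcal V_2$. The state is the pair of words of the stored classes of the two sides, in order of arrival. At each arrival, first the $j$-item is matched, if possible, with a compatible stored item of $\mathcal V_1$ chosen by the admissible policy $\Phi$, then the $i$-item likewise with a compatible stored item of $\mathcal V_2$. If exactly one of the two finds a match, the other is stored; if neither does, they are matched together if $i - j$, and both stored otherwise. Stability is positive recurrence of the chain, and the asymptotic matching rate $\Theta_{\mathrm b}^{\Phi,\tilde\mu}[i,j]$ is the mean number of matchings of an $i$-item with a $j$-item performed at an arrival, in the stationary regime. Let $\mathcal N_{\mathrm b}(G)$ be the set of measures $\mu$ with full support such that $\mu(\mathcal V_1)=\mu(\mathcal V_2)$ and $\mu(U)<\mu(\mathcal E(U))$ for all $U\subset\mathcal V$ with $U\ne\emptyset,\mathcal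 V,\mathcal V_1,\mathcal V_2$. *Policy-invariance.* The matching rates are policy-invariant for $G$ if: - when $G$ is not bipartite: for every $\mu\in\mathcal N(G)$, the rates $\Theta^{\Phi,\bar\mu}[i,j]$, $i,j\in\mathcal V$, are the same for all admissible policies $\Phi$ such that $(G,\Phi,\bar\mu)$ is stable; - when $G$ is bipartite, with bipartition $\mathcal V_1\cup\mathcal V_2$: for every $\mu\in\mathcal N_{\mathrm b}(G)$ and every law $\tilde\mu$ with full support on $\mathcal V_1\times\mathcal V_2$ whose marginals are $\mu(\cdot)/\mu(\mathcal V_1)$ on $\mathcal V_1$ and $\mu(\cdot)/\mu(\mathcal V_2)$ on $\mathcal V_2$, the rates $\Theta_{\mathrm b}^{\Phi,\tilde\mu}[i,j]$, $(i,j)\in\mathcal V_1\times\mathcal V_2$, are the same for all admissible policies $\Phi$ such that $(G,\Phi,\tilde\mu)$ is stable. **Theorem.** The matching rates are policy-invariant for $G$ in each of the following cases: 1. $G$ is a cycle of odd length (at least $3$); 2. $G$ is a tree; 3. $G$ is a tree with an additional edge that forms a cycle of odd length; 4. $G$ is a tree with an additional self-loop. -/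

import Mathlib

open scoped NNReal ENNReal

noncomputable section

/-! ### Positive recurrence and stationary distribution of a discrete Markov chain -/

namespace MarkovChain

variable {S : Type*}

open scoped Classical in
/-- The probability, starting from `x`, that the chain with transition kernel `P`
does not visit `y` at any of the times `1, …, n`. -/
def avoidProb (P : S → PMF S) (y : S) : ℕ → S → ℝ≥0∞
  | 0, _ => 1
  | n + 1, x => ∑' z, if z = y then 0 else P x z * avoidProb P y n z

/-- The mean return time to `y`: `E_y[T] = ∑_{n ≥ 0} P_y(T > n)`, where `T ≥ 1` is the first time
at which the chain started from `y` is back at `y`. -/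
def meanReturnTime (P : S → PMF S) (y : S) : ℝ≥0∞ :=
  ∑' n, avoidProb P y n y

/-- All states have a finite mean return time. -/
def PositiveRecurrent (P : S → PMF S) : Prop :=
  ∀ y, meanReturnTime P y ≠ ⊤

open scoped Classical in
/-- The stationary distribution of the chain (it exists and is unique for a positive recurrent
irreducible chain; null by convention if there is none). -/
def stationaryDist (P : S → PMF S) : S → ℝ≥0∞ :=
  if h : ∃ π : PMF S, π.bind P = π then fun x => h.choose x else fun _ => 0

end MarkovChain

/-! ### Multigraphs -/

/-- An undirected multigraph with simple edges, in which self-loops are allowed. -/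
structure Multigraph (V : Type*) where
  Adj : V → V → Prop
  symm : ∀ u v, Adj u v → Adj v u

/-- The positions of the list `l` that hold an element satisfying `R`. -/
def Candidates {α : Type*} (l : List α) (R : α → Prop) : Type :=
  {p : Fin l.length // R (l.get p)}

namespace Multigraph

variable {V : Type*}

/-- The multigraph (without self-loop) given by a simple graph. -/
def ofSimpleGraph (H : SimpleGraph V) : Multigraph V where
  Adj := H.Adj
  symm := fun _ _ h => h.symm

/-- `G` with an additional edge between `u` and `v` (a self-loop if `u = v`). -/
def addEdge (G : Multigraph V) (u v : V) : Multigraph V where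
  Adj a b := G.Adj a b ∨ (a = u ∧ b = v) ∨ (a = v ∧ b = u)
  symm := by
    rintro a b (h | ⟨h, h'⟩ | ⟨h, h'⟩)
    · exact Or.inl (G.symm _ _ h)
    · exact Or.inr (Or.inr ⟨h', h⟩)
    · exact Or.inr (Or.inl ⟨h', h⟩)

/-- `G` is a cycle of odd length (at least 3). -/
def IsOddCycle (G : Multigraph V) : Prop :=
  ∃ n, 3 ≤ n ∧ Odd n ∧
    ∃ e : Fin n ≃ V, ∀ a b, G.Adj (e a) (e b) ↔ (SimpleGraph.cycleGraph n).Adj a b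

/-- `G` is a tree. -/
def IsTree (G : Multigraph V) : Prop :=
  ∃ T : SimpleGraph V, T.IsTree ∧ G = ofSimpleGraph T

/-- `G` is a tree with an additional edge `u -- v`, where the cycle formed by this edge and the path
from `u` to `v` in the tree has odd length. -/
def IsTreePlusOddEdge (G : Multigraph V) : Prop :=
  ∃ (T : SimpleGraph V) (u v : V), T.IsTree ∧ u ≠ v ∧ ¬ T.Adj u v ∧ Odd (T.dist u v + 1) ∧
    G = (ofSimpleGraph T).addEdge u v

/-- `G` is a tree with an additional self-loop. -/
def IsTreePlusSelfLoop (G : Multigraph V) : Prop :=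
  ∃ (T : SimpleGraph V) (r : V), T.IsTree ∧ G = (ofSimpleGraph T).addEdge r r

/-- `(V₁, V₁ᶜ)` is a bipartition of `G`: both are non-empty independent sets. -/
def IsBipartition (G : Multigraph V) (V₁ : Set V) : Prop :=
  V₁.Nonempty ∧ V₁ᶜ.Nonempty ∧
    (∀ a ∈ V₁, ∀ b ∈ V₁, ¬ G.Adj a b) ∧ (∀ a ∈ V₁ᶜ, ∀ b ∈ V₁ᶜ, ¬ G.Adj a b)

def IsBipartite (G : Multigraph V) : Prop :=
  ∃ V₁ : Set V, G.IsBipartition V₁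

open scoped Classical in
/-- The mass `μ(U)`. -/
def mass [Fintype V] (μ : V → ℝ≥0) (U : Set V) : ℝ≥0 :=
  ∑ v with v ∈ U, μ v

/-- The neighborhood of `U`. -/
def nbhd (G : Multigraph V) (U : Set V) : Set V :=
  {v | ∃ u ∈ U, G.Adj u v}

/-- The set `N(G)` of measures with full support such that `μ(U) < μ(E(U))` for all
proper non-empty `U`. -/
def NCond [Fintype V] (G : Multigraph V) : Set (V → ℝ≥0) :=
  {μ | (∀ v, 0 < μ v) ∧ ∀ U : Set V, U ≠ ∅ → U ≠ Set.univ → mass μ U < mass μ (G.nbhd U)}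

/-- The bipartite analog `N_b(G)`, for the bipartition `(V₁, V₁ᶜ)`. -/
def NCondBip [Fintype V] (G : Multigraph V) (V₁ : Set V) : Set (V → ℝ≥0) :=
  {μ | (∀ v, 0 < μ v) ∧
    (∀ U : Set V, U ≠ ∅ → U ≠ Set.univ → U ≠ V₁ → U ≠ V₁ᶜ → mass μ U < mass μ (G.nbhd U)) ∧
    mass μ V₁ = mass μ V₁ᶜ}

/-! ### The general stochastic matching model -/

section General

variable (G : Multigraph V)

/-- The state space: words of the classes of the stored items in order of arrival, in which no two
items are compatible. -/
def Buffer : Type _ :=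
  {w : List V // w.Pairwise fun a b => ¬ G.Adj a b}

/-- An admissible matching policy: given the stored items in order of arrival and the class `i` of
an incoming item that has a compatible item in line, the law of the (possibly random) position of
the stored compatible item that is matched with the incoming one. The draws at distinct arrivals
are independent. -/
def Policy : Type _ :=
  ∀ (w : List V) (i : V), Nonempty (Candidates w (G.Adj i)) → PMF (Candidates w (G.Adj i))

variable {G}

open scoped Classical in
/-- Arrival of an `i`-item in the buffer `w`: joint law of the next buffer and of the
class of the match of the incoming item (`none` if it is stored). -/
def step (Φ : G.Policy) (w : G.Buffer) (i : V) : PMF (G.Buffer × Option V) :=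
  if h : Nonempty (Candidates w.1 (G.Adj i)) then
    (Φ w.1 i h).map fun p =>
      (⟨w.1.eraseIdx p.1, w.2.sublist (List.eraseIdx_sublist _ _)⟩, some (w.1.get p.1))
  else
    PMF.pure (⟨w.1 ++ [i], by
      refine List.pairwise_append.2 ⟨w.2, List.pairwise_singleton _ _, fun a ha b hb hab => ?_⟩
      rw [List.mem_singleton] at hb
      subst hb
      obtain ⟨p, rfl⟩ := List.mem_iff_get.1 ha
      exact h ⟨⟨p, G.symm _ _ hab⟩⟩⟩, none)

/-- The transition kernel of the chain of the model `(G, Φ, p)`, the classes of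
the incoming items being IID of law `p`. -/
def chain (Φ : G.Policy) (p : PMF V) (w : G.Buffer) : PMF G.Buffer :=
  p.bind fun i => (step Φ w i).map Prod.fst

/-- The model `(G, Φ, p)` is stable. -/
def Stable (Φ : G.Policy) (p : PMF V) : Prop :=
  MarkovChain.PositiveRecurrent (chain Φ p)

/-- The stationary probability that an incoming `i`-item gets matched with a stored `j`-item. -/
def matchProb (Φ : G.Policy) (p : PMF V) (i j : V) : ℝ≥0∞ :=
  ∑' w, MarkovChain.stationaryDist (chain Φ p) w * ((step Φ w i).map Prod.snd) (some j)

open scoped Classical in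
/-- The asymptotic matching rate of `i` with `j`. -/
def matchingRate (Φ : G.Policy) (p : PMF V) (i j : V) : ℝ≥0∞ :=
  p i * matchProb Φ p i j + if i = j then 0 else p j * matchProb Φ p j i

end General

/-- The normalized probability measure of a measure with full support. -/
def normalized [Fintype V] [Nonempty V] (μ : V → ℝ≥0) (hμ : ∀ v, 0 < μ v) : PMF V :=
  PMF.normalize (fun v => (μ v : ℝ≥0∞))
    (by
      rw [Ne, ENNReal.tsum_eq_zero, not_forall]
      obtain ⟨v⟩ := ‹Nonempty V›
      exact ⟨v, by simpa using (hμ v).ne'⟩)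
    (by
      rw [tsum_fintype]
      exact ENNReal.sum_ne_top.2 fun v _ => ENNReal.coe_ne_top)

/-- Policy-invariance of the matching rates of the general stochastic matching model. -/
def GeneralPolicyInvariant [Fintype V] [Nonempty V] (G : Multigraph V) : Prop :=
  ∀ (μ : V → ℝ≥0) (hμ : μ ∈ G.NCond) (Φ Φ' : G.Policy),
    Stable Φ (normalized μ hμ.1) → Stable Φ' (normalized μ hμ.1) →
      ∀ i j, matchingRate Φ (normalized μ hμ.1) i j = matchingRate Φ' (normalized μ hμ.1) i j

/-! ### The extended bipartite stochastic matching model -/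

section Bipartite

variable (G : Multigraph V) (V₁ : Set V)

/-- The state space: the words `(u, v)` of the classes of the stored items of the two sides, in order
of arrival. They have the same length and no stored item of `u` is compatible with one of `v`. -/
def BipBuffer : Type _ :=
  {w : List V₁ × List ↥(V₁ᶜ) //
    w.1.length = w.2.length ∧ ∀ a ∈ w.1, ∀ b ∈ w.2, ¬ G.Adj a b}

/-- An admissible matching policy: given the buffer `(u, v)`, the law of the position of the stored
compatible item with which an incoming item is matched. -/
structure BipPolicy where
  /-- match of an incoming item of class `i ∈ V₁` -/
  left : ∀ (_ : List V₁) (v : List ↥(V₁ᶜ)) (i : V₁),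
    Nonempty (Candidates v fun b => G.Adj i b) → PMF (Candidates v fun b => G.Adj i b)
  /-- match of an incoming item of class `j ∈ V₁ᶜ` -/
  right : ∀ (u : List V₁) (_ : List ↥(V₁ᶜ)) (j : ↥(V₁ᶜ)),
    Nonempty (Candidates u fun a => G.Adj a j) → PMF (Candidates u fun a => G.Adj a j)

variable {G V₁}

open scoped Classical in
/-- Arrival of a couple `(i, j)` in the buffer `(u, v)`: joint law of the next buffer and of the list
of the matchings that are performed. First the incoming `j`-item is matched with a compatible stored
item of `u`, if any; then the incoming `i`-item is matched with a compatible stored item of `v`,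
if any. If only one of them finds a match the other one is stored. If none does, they are
matched together if they are compatible, and both stored otherwise. -/
def bipStep (Φ : G.BipPolicy V₁) (w : G.BipBuffer V₁) (i : V₁) (j : ↥(V₁ᶜ)) :
    PMF (G.BipBuffer V₁ × List (V₁ × ↥(V₁ᶜ))) :=
  if hj : Nonempty (Candidates w.1.1 fun a => G.Adj a j) then
    (Φ.right w.1.1 w.1.2 j hj).bind fun p =>
      if hi : Nonempty (Candidates w.1.2 fun b => G.Adj i b) then
        (Φ.left (w.1.1.eraseIdx p.1) w.1.2 i hi).map fun q =>
          (⟨(w.1.1.eraseIdx p.1, w.1.2.eraseIdx q.1), by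
            refine ⟨?_, fun a ha b hb =>
              w.2.2 a (List.mem_of_mem_eraseIdx ha) b (List.mem_of_mem_eraseIdx hb)⟩
            have := w.2.1
            have := p.1.2
            have := q.1.2
            simp only [List.length_eraseIdx]
            split <;> omega⟩,
            [(w.1.1.get p.1, j), (i, w.1.2.get q.1)])
      else
        PMF.pure (⟨(w.1.1.eraseIdx p.1 ++ [i], w.1.2), by
          refine ⟨?_, fun a ha b hb hab => ?_⟩
          · have := w.2.1
            have := p.1.2
            simp only [List.length_append, List.length_eraseIdx, List.length_singleton]
            split <;> omega
          · rcases List.mem_append.1 ha with ha | ha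
            · exact w.2.2 a (List.mem_of_mem_eraseIdx ha) b hb hab
            · rw [List.mem_singleton] at ha
              subst ha
              obtain ⟨q, rfl⟩ := List.mem_iff_get.1 hb
              exact hi ⟨⟨q, hab⟩⟩⟩,
          [(w.1.1.get p.1, j)])
  else if hi : Nonempty (Candidates w.1.2 fun b => G.Adj i b) then
    (Φ.left w.1.1 w.1.2 i hi).map fun q =>
      (⟨(w.1.1, w.1.2.eraseIdx q.1 ++ [j]), by
        refine ⟨?_, fun a ha b hb hab => ?_⟩
        · have := w.2.1
          have := q.1.2
          simp only [List.length_append, List.length_eraseIdx, List.length_singleton]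
          split <;> omega
        · rcases List.mem_append.1 hb with hb | hb
          · exact w.2.2 a ha b (List.mem_of_mem_eraseIdx hb) hab
          · rw [List.mem_singleton] at hb
            subst hb
            obtain ⟨p, rfl⟩ := List.mem_iff_get.1 ha
            exact hj ⟨⟨p, hab⟩⟩⟩,
        [(i, w.1.2.get q.1)])
  else if hij : G.Adj i j then
    PMF.pure (w, [(i, j)])
  else
    PMF.pure (⟨(w.1.1 ++ [i], w.1.2 ++ [j]), by
      refine ⟨by simp [w.2.1], fun a ha b hb hab => ?_⟩
      rcases List.mem_append.1 ha with ha' | ha' <;> rcases List.mem_append.1 hb with hb' | hb'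
      · exact w.2.2 a ha' b hb' hab
      · rw [List.mem_singleton.1 hb'] at hab
        obtain ⟨p, rfl⟩ := List.mem_iff_get.1 ha'
        exact hj ⟨⟨p, hab⟩⟩
      · rw [List.mem_singleton.1 ha'] at hab
        obtain ⟨q, rfl⟩ := List.mem_iff_get.1 hb'
        exact hi ⟨⟨q, hab⟩⟩
      · rw [List.mem_singleton.1 ha', List.mem_singleton.1 hb'] at hab
        exact hij hab⟩, [])

/-- The transition kernel of the chain of the bipartite model `(G, Φ, p)`, the classes
of the incoming couples being IID of law `p`. -/
def bipChain (Φ : G.BipPolicy V₁) (p : PMF (V₁ × ↥(V₁ᶜ))) (w : G.BipBuffer V₁) :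
    PMF (G.BipBuffer V₁) :=
  p.bind fun c => (bipStep Φ w c.1 c.2).map Prod.fst

/-- The bipartite model `(G, Φ, p)` is stable. -/
def BipStable (Φ : G.BipPolicy V₁) (p : PMF (V₁ × ↥(V₁ᶜ))) : Prop :=
  MarkovChain.PositiveRecurrent (bipChain Φ p)

open scoped Classical in
/-- The asymptotic matching rate of `i` with `j`: the mean number, in the stationary regime, of
matchings of an `i`-item with a `j`-item that are performed at an arrival. -/
def bipMatchingRate (Φ : G.BipPolicy V₁) (p : PMF (V₁ × ↥(V₁ᶜ))) (i : V₁) (j : ↥(V₁ᶜ)) : ℝ≥0∞ :=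
  ∑' w, MarkovChain.stationaryDist (bipChain Φ p) w *
    ∑' c, p c * ∑' x, bipStep Φ w c.1 c.2 x * (x.2.count (i, j) : ℝ≥0∞)

end Bipartite

/-- Policy-invariance of the matching rates of the extended bipartite stochastic matching model, for
the bipartition `(V₁, V₁ᶜ)`. Here `p` is a law of couples with full support, whose marginals are the
restrictions of `μ` to the two sides, normalized. -/
def BipPolicyInvariant [Fintype V] (G : Multigraph V) (V₁ : Set V) : Prop :=
  ∀ μ ∈ G.NCondBip V₁, ∀ p : PMF (V₁ × ↥(V₁ᶜ)), (∀ c, p c ≠ 0) →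
    (∀ i : V₁, p.map Prod.fst i = (μ i : ℝ≥0∞) / (mass μ V₁ : ℝ≥0∞)) →
    (∀ j : ↥(V₁ᶜ), p.map Prod.snd j = (μ j : ℝ≥0∞) / (mass μ V₁ᶜ : ℝ≥0∞)) →
    ∀ Φ Φ' : G.BipPolicy V₁, BipStable Φ p → BipStable Φ' p →
      ∀ i j, bipMatchingRate Φ p i j = bipMatchingRate Φ' p i j

/-- The matching rates are policy-invariant for `G`. The model is the general one if `G` is not
bipartite, and the extended bipartite one if `G` is bipartite. -/
def PolicyInvariant [Fintype V] [Nonempty V] (G : Multigraph V) : Prop :=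
  (¬ G.IsBipartite → G.GeneralPolicyInvariant) ∧
    ∀ V₁ : Set V, G.IsBipartition V₁ → G.BipPolicyInvariant V₁

end Multigraph

end

/-! In the stationary regime the number of stored `k`-items has the same law before and after an
arrival, so `k`-items enter and leave at the same rate. Hence the rates at the edges around `k` add
up to the probability that an incoming item is of class `k`, a match along a self-loop counting
twice because it consumes two `k`-items (`sum_matchingRate`). In the bipartite model the row and
column sums of the rates are likewise the two marginals of the law of the couples. The right-hand
sides do not involve the policy, and the rates vanish off the edges, so policy-invariance follows
once this linear system has at most one solution (`IncidenceInjective.eq`).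

Its matrix is the unsigned incidence matrix of `G`, with entry 2 at a self-loop. The columns are
independent as soon as each edge admits a node potential whose sum over the ends is zero at every
other edge but not at this one (`eq_zero_of_potential`). Such potentials are signs alternating along
the graph: around an odd cycle opened at the edge, or on one side of an edge of a tree. For an edge
or loop added to a tree, signs alternating over the whole tree isolate it, and the tree case handles
the rest.

Two points of probability remain. The number of stored items may have infinite mean, so conservation
is proved by truncation (`PMF.tsum_mul_le_of_map_eq`, `MarkovChain.tsum_mul_eq_of_stationary`).
Positive recurrence has to yield an invariant law, which is the normalized occupation measure of an
excursion (`MarkovChain.exists_stationary`). -/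

noncomputable section

/-! ### Expectations under discrete laws and truncation -/

namespace PMF

variable {α β : Type*}

theorem tsum_bind_mul (p : PMF α) (f : α → PMF β) (g : β → ℝ≥0∞) :
    ∑' b, p.bind f b * g b = ∑' a, p a * ∑' b, f a b * g b := by
  simp_rw [PMF.bind_apply, ← ENNReal.tsum_mul_right, ← ENNReal.tsum_mul_left]
  rw [ENNReal.tsum_comm]
  simp_rw [mul_assoc]

theorem tsum_pure_mul (a : α) (g : α → ℝ≥0∞) : ∑' b, PMF.pure a b * g b = g a := by
  rw [tsum_eq_single a]
  · simp
  · intro b hb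
    simp [PMF.pure_apply, hb]

theorem tsum_map_mul (p : PMF α) (f : α → β) (g : β → ℝ≥0∞) :
    ∑' b, p.map f b * g b = ∑' a, p a * g (f a) := by
  rw [PMF.map, tsum_bind_mul]
  simp only [Function.comp_apply, tsum_pure_mul]

theorem tsum_mul_le_tsum_mul (p : PMF α) {f g : α → ℝ≥0∞} (h : ∀ a ∈ p.support, f a ≤ g a) :
    ∑' a, p a * f a ≤ ∑' a, p a * g a := by
  refine ENNReal.tsum_le_tsum fun a => ?_
  by_cases ha : a ∈ p.support
  · exact mul_le_mul_right (h a ha) _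
  · rw [PMF.mem_support_iff, not_not] at ha
    simp [ha]

theorem tsum_mul_const (p : PMF α) (c : ℝ≥0∞) : ∑' a, p a * c = c := by
  rw [ENNReal.tsum_mul_right, p.tsum_coe, one_mul]

/-- The tail of a law on `ℕ` tends to zero. -/
theorem tendsto_tail (q : PMF ℕ) :
    Filter.Tendsto (fun N => ∑' n, q n * if N ≤ n then 1 else 0) Filter.atTop (nhds 0) := by
  have h := ENNReal.tendsto_sum_nat_add q q.tsum_coe_ne_top
  refine h.congr fun N => ?_
  rw [← (ENNReal.summable (f := fun k => q (k + N) * if N ≤ k + N then 1 else 0)).sum_add_tsum_nat_add'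
    (f := fun n => q n * if N ≤ n then 1 else 0)]
  rw [Finset.sum_eq_zero, zero_add]
  · simp
  · intro n hn
    have := Finset.mem_range.1 hn
    simp [this]

/-- If two integer random variables `X` and `Y` have the same law (possibly not integrable) and
`X + a ≤ Y + b` then `E[a] ≤ E[b]`. -/
theorem tsum_mul_le_of_map_eq (J : PMF α) (X Y a b : α → ℕ) (C : ℕ) (hXY : J.map X = J.map Y)
    (h : ∀ x ∈ J.support, X x + a x ≤ Y x + b x) (ha : ∀ x ∈ J.support, a x ≤ C) :
    ∑' x, J x * (a x : ℝ≥0∞) ≤ ∑' x, J x * (b x : ℝ≥0∞) := by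
  -- Truncation at `N` makes the means of `X` and `Y` finite and still equal, so they cancel. The
  -- inequality survives truncation except where `N ≤ Y`; there `min X N ≤ N = min Y N`, and the
  -- bound `a ≤ C` pays for the error. The error vanishes as `N` grows.
  have key : ∀ N : ℕ, ∑' x, J x * (a x : ℝ≥0∞) ≤
      ∑' x, J x * (b x : ℝ≥0∞) + C * ∑' n, J.map Y n * if N ≤ n then 1 else 0 := by
    intro N
    have hfin : ∑' x, J x * ((min (X x) N : ℕ) : ℝ≥0∞) ≠ ⊤ := by
      refine ne_top_of_le_ne_top (ENNReal.natCast_ne_top N) ?_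
      rw [← J.tsum_mul_const (N : ℝ≥0∞)]
      exact J.tsum_mul_le_tsum_mul fun x _ => by exact_mod_cast min_le_right _ _
    have hmin : ∑' x, J x * ((min (X x) N : ℕ) : ℝ≥0∞) =
        ∑' x, J x * ((min (Y x) N : ℕ) : ℝ≥0∞) := by
      rw [← J.tsum_map_mul X fun n => ((min n N : ℕ) : ℝ≥0∞), hXY, J.tsum_map_mul]
    refine (ENNReal.add_le_add_iff_left hfin).1 ?_
    conv_rhs => rw [hmin]
    rw [J.tsum_map_mul, ← ENNReal.tsum_mul_left, ← ENNReal.tsum_add, ← ENNReal.tsum_add,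
      ← ENNReal.tsum_add]
    have hle := J.tsum_mul_le_tsum_mul
      (f := fun x => ((min (X x) N : ℕ) : ℝ≥0∞) + a x)
      (g := fun x => ((min (Y x) N : ℕ) : ℝ≥0∞) + (b x + C * if N ≤ Y x then 1 else 0)) (by
        intro x hx
        have h1 := h x hx
        have h2 := ha x hx
        split_ifs with hN
        · rw [mul_one]
          norm_cast
          omega
        · rw [mul_zero, add_zero]
          norm_cast
          omega)
    simp only [mul_add] at hle
    convert hle using 5
    ring
  have ht : Filter.Tendsto
      (fun N => ∑' x, J x * (b x : ℝ≥0∞) + C * ∑' n, J.map Y n * if N ≤ n then 1 else 0)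
      Filter.atTop (nhds (∑' x, J x * (b x : ℝ≥0∞) + C * 0)) :=
    tendsto_const_nhds.add
      (ENNReal.Tendsto.const_mul (J.map Y).tendsto_tail (Or.inr (ENNReal.natCast_ne_top C)))
  rw [mul_zero, add_zero] at ht
  exact ge_of_tendsto' ht key

end PMF

/-! ### Rate conservation in the stationary regime -/

namespace MarkovChain

variable {S O : Type*}

/-- Rate conservation: in the stationary regime of a chain, if the integer-valued function `f` of
the state grows by `b - a` at each step, then `a` and `b` have the same mean. -/
theorem tsum_mul_eq_of_stationary (π : PMF S) (K : S → PMF (S × O))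
    (hπ : π.bind (fun w => (K w).map Prod.fst) = π) (f : S → ℕ) (a b : O → ℕ) (C : ℕ)
    (h : ∀ w, ∀ x ∈ (K w).support, f x.1 + a x.2 = f w + b x.2)
    (ha : ∀ w, ∀ x ∈ (K w).support, a x.2 ≤ C) (hb : ∀ w, ∀ x ∈ (K w).support, b x.2 ≤ C) :
    ∑' w, π w * ∑' x, K w x * (a x.2 : ℝ≥0∞) = ∑' w, π w * ∑' x, K w x * (b x.2 : ℝ≥0∞) := by
  -- Joint law of the current state, the next state and the outcome. Both states have law `π`, so
  -- `f` has the same law before and after the step, integrable or not.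
  set J : PMF (S × (S × O)) := π.bind fun w => (K w).map (Prod.mk w) with hJ
  have hE : ∀ g : O → ℕ, ∑' w, π w * ∑' x, K w x * (g x.2 : ℝ≥0∞) =
      ∑' y, J y * (g y.2.2 : ℝ≥0∞) := by
    intro g
    rw [hJ, PMF.tsum_bind_mul]
    simp_rw [PMF.tsum_map_mul]
  have hsupp : ∀ y ∈ J.support, y.2 ∈ (K y.1).support := by
    intro y hy
    rw [hJ, PMF.mem_support_bind_iff] at hy
    obtain ⟨w, -, hw⟩ := hy
    rw [PMF.mem_support_map_iff] at hw
    obtain ⟨x, hx, rfl⟩ := hw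
    exact hx
  have h1 : J.map (fun y => y.1) = π := by
    rw [hJ, PMF.map_bind]
    simp_rw [PMF.map_comp]
    have : ∀ w : S, (fun y : S × (S × O) => y.1) ∘ Prod.mk w = Function.const _ w := fun w => rfl
    simp_rw [this, PMF.map_const, PMF.bind_pure]
  have h2 : J.map (fun y => y.2.1) = π := by
    rw [hJ, PMF.map_bind]
    simp_rw [PMF.map_comp]
    exact hπ
  have hlaw : J.map (fun y => f y.2.1) = J.map (fun y => f y.1) := by
    change J.map (f ∘ fun y => y.2.1) = J.map (f ∘ fun y => y.1)
    rw [← PMF.map_comp, ← PMF.map_comp, h1, h2]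
  rw [hE, hE]
  exact le_antisymm
    (J.tsum_mul_le_of_map_eq _ _ _ _ C hlaw (fun y hy => (h _ _ (hsupp y hy)).le)
      fun y hy => ha _ _ (hsupp y hy))
    (J.tsum_mul_le_of_map_eq _ _ _ _ C hlaw.symm (fun y hy => (h _ _ (hsupp y hy)).ge)
      fun y hy => hb _ _ (hsupp y hy))

/-! ### Existence of an invariant law -/

open scoped Classical in
/-- The probability that the chain started from `y` is at `z` at time `n` without having visited
`y` at the times `1, …, n`. -/
def tabooProb (P : S → PMF S) (y : S) : ℕ → S → ℝ≥0∞
  | 0, z => if z = y then 1 else 0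
  | n + 1, z => if z = y then 0 else ∑' x, tabooProb P y n x * P x z

/-- A path that avoids `y` up to time `m + n` is cut at time `m`. With `n = 0` this says that the
taboo mass at time `m` is the probability that the return time exceeds `m`, so the occupation
measure of an excursion has the mean return time as total mass. -/
theorem tsum_tabooProb_mul_avoidProb (P : S → PMF S) (y : S) (m n : ℕ) :
    ∑' x, tabooProb P y m x * avoidProb P y n x = avoidProb P y (m + n) y := by
  induction m generalizing n with
  | zero => simp [tabooProb]
  | succ m ih =>
    rw [show m + 1 + n = m + (n + 1) by ring, ← ih (n + 1)]
    simp only [tabooProb, avoidProb]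
    simp_rw [← ENNReal.tsum_mul_left]
    rw [ENNReal.tsum_comm]
    refine tsum_congr fun z => ?_
    by_cases hz : z = y
    · simp [hz]
    · simp [hz, ← ENNReal.tsum_mul_right, mul_assoc]

/-- A chain with a positive recurrent state has a stationary distribution. -/
theorem exists_stationary (P : S → PMF S) (y : S) (hy : meanReturnTime P y ≠ ⊤) :
    ∃ π : PMF S, π.bind P = π := by
  classical
  -- Expected number of visits to each state during an excursion from `y`, the start included and
  -- the return excluded.
  set m : S → ℝ≥0∞ := fun z => ∑' n, tabooProb P y n z with hm
  have hsum : ∑' z, m z = meanReturnTime P y := by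
    rw [hm, ENNReal.tsum_comm, meanReturnTime]
    refine tsum_congr fun n => ?_
    simpa [avoidProb] using tsum_tabooProb_mul_avoidProb P y n 0
  have hfin : ∑' z, m z ≠ ⊤ := hsum ▸ hy
  have hmy : m y ≠ 0 := by
    intro h
    have := ENNReal.tsum_eq_zero.1 h 0
    simp [tabooProb] at this
  have hne : ∀ z, z ≠ y → ∑' x, m x * P x z = m z := by
    intro z hz
    simp_rw [hm, ← ENNReal.tsum_mul_right]
    rw [ENNReal.tsum_comm]
    conv_rhs => rw [tsum_eq_zero_add' ENNReal.summable]
    simp [tabooProb, hz]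
  -- The taboo recursion gives invariance only away from `y`. At `y` it follows because the kernel
  -- preserves the total mass, which is finite, and all other coordinates already agree.
  have htot : ∑' z, ∑' x, m x * P x z = ∑' z, m z := by
    rw [ENNReal.tsum_comm]
    simp_rw [ENNReal.tsum_mul_left, PMF.tsum_coe, mul_one]
  have hinv : ∀ z, ∑' x, m x * P x z = m z := by
    intro z
    by_cases hz : z = y
    · subst hz
      rw [ENNReal.tsum_eq_add_tsum_ite z] at htot
      conv_rhs at htot => rw [ENNReal.tsum_eq_add_tsum_ite z]
      have heq : (∑' w, if w = z then 0 else ∑' x, m x * P x w) = ∑' w, if w = z then 0 else m w := by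
        refine tsum_congr fun w => ?_
        split_ifs with hw
        · rfl
        · exact hne w hw
      rw [heq] at htot
      refine (ENNReal.add_left_inj (ne_top_of_le_ne_top hfin ?_)).1 htot
      refine ENNReal.tsum_le_tsum fun w => ?_
      split_ifs
      · exact zero_le
      · exact le_rfl
    · exact hne z hz
  have hne0 : ∑' z, m z ≠ 0 := fun h => hmy (ENNReal.tsum_eq_zero.1 h y)
  refine ⟨PMF.normalize m hne0 hfin, ?_⟩
  ext z
  rw [PMF.bind_apply]
  simp_rw [PMF.normalize_apply]
  rw [← hinv z, ← ENNReal.tsum_mul_right]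
  refine tsum_congr fun x => ?_
  ring

/-- Rate conservation holds under every invariant law, so it is enough that the chosen one is
invariant; uniqueness plays no role. -/
theorem PositiveRecurrent.exists_stationaryDist_eq [Nonempty S] {P : S → PMF S}
    (h : PositiveRecurrent P) : ∃ π : PMF S, π.bind P = π ∧ stationaryDist P = π := by
  have hex : ∃ π : PMF S, π.bind P = π :=
    exists_stationary P (Classical.arbitrary S) (h _)
  refine ⟨hex.choose, hex.choose_spec, ?_⟩
  ext x
  rw [stationaryDist, dif_pos hex]

end MarkovChain

namespace Multigraph

/-! ### Column rank of the unsigned incidence matrix -/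

section Incidence

variable {V : Type*} [Fintype V]

/-- The edge weights of `G` are determined by the total weights at the nodes, self-loops being
counted twice: the unsigned incidence matrix of `G` has full column rank. -/
def IncidenceInjective (G : Multigraph V) : Prop :=
  ∀ x : V → V → ℝ, (∀ i j, x i j = x j i) → (∀ i j, x i j ≠ 0 → G.Adj i j) →
    (∀ i, ∑ j, x i j + x i i = 0) → ∀ i j, x i j = 0

/-- An edge weight vanishes if some node potential separates this edge from all the others. -/
theorem eq_zero_of_potential {x : V → V → ℝ} (hsymm : ∀ i j, x i j = x j i)
    (hrow : ∀ i, ∑ j, x i j + x i i = 0) (c : V → ℝ) {u v : V} (huv : c u + c v ≠ 0)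
    (hc : ∀ i j, x i j ≠ 0 → c i + c j = 0 ∨ (i = u ∧ j = v) ∨ (i = v ∧ j = u)) :
    x u v = 0 := by
  -- Weighting the node equations by `c` and symmetrizing leaves only the terms at `(u, v)` and `(v,
  -- u)`. Multiplying by the term at `(u, v)` makes each of them a square, so the cases `u = v` and
  -- `u ≠ v` need no separation.
  have hnonneg : ∀ i j, 0 ≤ (c i + c j) * x i j * ((c u + c v) * x u v) := by
    intro i j
    by_cases hx : x i j = 0
    · simp [hx]
    · rcases hc i j hx with h | ⟨rfl, rfl⟩ | ⟨rfl, rfl⟩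
      · simp [h]
      · exact mul_self_nonneg _
      · rw [add_comm (c i), hsymm i j]
        exact mul_self_nonneg _
  have h1 : ∑ i, ∑ j, c i * x i j + ∑ i, c i * x i i = 0 := by
    rw [← Finset.sum_add_distrib]
    refine Finset.sum_eq_zero fun i _ => ?_
    rw [← Finset.mul_sum, ← mul_add, hrow, mul_zero]
  have h2 : ∑ i, ∑ j, c j * x i j = ∑ i, ∑ j, c i * x i j := by
    rw [Finset.sum_comm]
    exact Finset.sum_congr rfl fun i _ => Finset.sum_congr rfl fun j _ => by rw [hsymm]
  have h3 : ∑ i, ∑ j, (c i + c j) * x i j + ∑ i, (c i + c i) * x i i = 0 := by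
    simp_rw [add_mul, Finset.sum_add_distrib]
    rw [h2]
    linarith
  have h4 : ∑ i, ∑ j, (c i + c j) * x i j * ((c u + c v) * x u v) +
      ∑ i, (c i + c i) * x i i * ((c u + c v) * x u v) = 0 := by
    simp_rw [← Finset.sum_mul]
    rw [← add_mul, h3, zero_mul]
  have h5 : (c u + c v) * x u v * ((c u + c v) * x u v) ≤
      ∑ i, ∑ j, (c i + c j) * x i j * ((c u + c v) * x u v) :=
    (Finset.single_le_sum (f := fun j => (c u + c j) * x u j * ((c u + c v) * x u v))
      (fun j _ => hnonneg u j) (Finset.mem_univ v)).trans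
      (Finset.single_le_sum
        (f := fun i => ∑ j, (c i + c j) * x i j * ((c u + c v) * x u v))
        (fun i _ => Finset.sum_nonneg fun j _ => hnonneg i j) (Finset.mem_univ u))
  have h6 : 0 ≤ ∑ i, (c i + c i) * x i i * ((c u + c v) * x u v) :=
    Finset.sum_nonneg fun i _ => hnonneg i i
  have h7 : (c u + c v) * x u v = 0 := mul_self_eq_zero.1 (le_antisymm (by linarith)
    (mul_self_nonneg _))
  exact (mul_eq_zero.1 h7).resolve_left huv

/-- Opening the cycle at an edge leaves a path with an even number of edges. Signs alternating along
it agree at its two ends, which are the ends of the removed edge. -/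
theorem IsOddCycle.incidenceInjective {G : Multigraph V} (hG : G.IsOddCycle) :
    G.IncidenceInjective := by
  obtain ⟨n, hn, hodd, e, he⟩ := hG
  obtain ⟨m, rfl⟩ : ∃ m, n = m + 2 := ⟨n - 2, by omega⟩
  intro x hsymm hsupp hrow
  have hadj : ∀ a b, x a b ≠ 0 → e.symm a = e.symm b + 1 ∨ e.symm b = e.symm a + 1 := by
    intro a b hab
    have h := hsupp a b hab
    rw [← e.apply_symm_apply a, ← e.apply_symm_apply b, he, SimpleGraph.cycleGraph_adj] at h
    rcases h with h | h
    · exact Or.inl (sub_eq_iff_eq_add'.1 h)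
    · exact Or.inr (sub_eq_iff_eq_add'.1 h)
  have key : ∀ a b, e.symm b = e.symm a + 1 → x a b = 0 := by
    intro a b hab
    set c : V → ℝ := fun w => (-1) ^ (e.symm w - e.symm b).val with hcdef
    have hstep : ∀ i j, e.symm j = e.symm i + 1 → c i + c j = 0 ∨ (i = a ∧ j = b) := by
      intro i j hij
      have h1 : e.symm j - e.symm b = (e.symm i - e.symm b) + 1 := by
        rw [hij, add_sub_right_comm]
      -- Positions are counted from `b` around the cycle. The sign flips at each step except the one
      -- from the last position back to `b`, which is the edge from `a` to `b`.
      by_cases hd : e.symm i - e.symm b = Fin.last (m + 1)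
      · right
        have h2 : e.symm j = e.symm b := by
          rw [← sub_eq_zero, h1, hd, Fin.last_add_one]
        refine ⟨e.symm.injective ?_, e.symm.injective h2⟩
        exact add_right_cancel (hij.symm.trans (h2.trans hab))
      · left
        simp only [hcdef]
        rw [h1, Fin.val_add_one, if_neg hd, pow_succ]
        ring
    refine eq_zero_of_potential hsymm hrow c (u := a) (v := b) ?_ ?_
    -- `a` is at the last position `m + 1`, which is even since the length `m + 2` is odd; the signs
    -- at `a` and `b` are both 1.
    · have h1 : e.symm a - e.symm b = Fin.last (m + 1) := by
        rw [hab, eq_comm, ← add_left_inj 1, Fin.last_add_one]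
        abel
      have h2 : Even (m + 1) := by
        rcases Nat.even_or_odd (m + 1) with h | h
        · exact h
        · exact absurd hodd (by rw [Nat.not_odd_iff_even]; exact h.add_one)
      simp only [hcdef]
      rw [h1, Fin.val_last, h2.neg_one_pow]
      simp
    · intro i j hx
      rcases hadj i j hx with h | h
      · rcases hstep j i h with h' | h'
        · exact Or.inl (by rw [add_comm]; exact h')
        · exact Or.inr (Or.inr ⟨h'.2, h'.1⟩)
      · rcases hstep i j h with h' | h'
        · exact Or.inl h'
        · exact Or.inr (Or.inl h')
  intro a b
  by_contra hab
  rcases hadj a b hab with h | h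
  · exact hab (by rw [hsymm]; exact key b a h)
  · exact hab (key a b h)

theorem neg_one_pow_dist_add_eq_zero {V : Type*} {T : SimpleGraph V} (hT : T.IsTree) (r : V)
    {i j : V} (hij : T.Adj i j) : (-1 : ℝ) ^ T.dist r i + (-1) ^ T.dist r j = 0 := by
  rcases hT.dist_eq_dist_add_one_of_adj r hij with h | h <;> rw [h, pow_succ] <;> ring

/-- Every edge of a tree is a bridge. The potential has alternating signs on the side of `a` and is
zero on the side of `b`, so its sum over the ends is 1 at the bridge and 0 at every other edge. -/
theorem incidenceInjective_ofSimpleGraph {T : SimpleGraph V} (hT : T.IsTree) :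
    (ofSimpleGraph T).IncidenceInjective := by
  classical
  intro x hsymm hsupp hrow a b
  by_contra hab
  have hadj : T.Adj a b := hsupp a b hab
  have hbridge := SimpleGraph.isBridge_iff.1
    (SimpleGraph.isAcyclic_iff_forall_adj_isBridge.1 hT.isAcyclic hadj)
  set D := T.deleteEdges {s(a, b)} with hD
  refine hab (eq_zero_of_potential hsymm hrow
    (fun i => if D.Reachable a i then (-1) ^ T.dist a i else 0) ?_ ?_)
  · simp [hbridge]
  · intro i j hx
    have hij : T.Adj i j := hsupp i j hx
    by_cases he : s(i, j) = s(a, b)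
    · exact Or.inr (by simpa using he)
    · left
      have hDij : D.Adj i j := by
        rw [hD, SimpleGraph.deleteEdges_adj]
        exact ⟨hij, he⟩
      have hiff : D.Reachable a i ↔ D.Reachable a j :=
        ⟨fun h => h.trans hDij.reachable, fun h => h.trans hDij.symm.reachable⟩
      by_cases h : D.Reachable a j
      · simp only [hiff.2 h, h, if_true]
        exact neg_one_pow_dist_add_eq_zero hT a hij
      · simp [hiff, h]

/-- Signs given by the parity of the distance to `u` cancel on all tree edges but agree at `u` and
`v`, so the added edge has weight zero and the tree remains. A self-loop is the case of distance 0.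
-/
theorem incidenceInjective_addEdge {T : SimpleGraph V} (hT : T.IsTree) {u v : V}
    (huv : Even (T.dist u v)) : ((ofSimpleGraph T).addEdge u v).IncidenceInjective := by
  intro x hsymm hsupp hrow
  have h0 : x u v = 0 := by
    refine eq_zero_of_potential hsymm hrow (fun i => (-1) ^ T.dist u i) ?_ ?_
    · simp [huv.neg_one_pow]
    · intro i j hx
      exact (hsupp i j hx).imp_left fun h => neg_one_pow_dist_add_eq_zero hT u h
  refine incidenceInjective_ofSimpleGraph hT x hsymm (fun i j hx => ?_) hrow
  rcases hsupp i j hx with h | ⟨rfl, rfl⟩ | ⟨rfl, rfl⟩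
  · exact h
  · exact absurd h0 hx
  · exact absurd h0 (by rwa [hsymm] at hx)

theorem IsTree.incidenceInjective {G : Multigraph V} (hG : G.IsTree) : G.IncidenceInjective := by
  obtain ⟨T, hT, rfl⟩ := hG
  exact incidenceInjective_ofSimpleGraph hT

theorem IsTreePlusOddEdge.incidenceInjective {G : Multigraph V} (hG : G.IsTreePlusOddEdge) :
    G.IncidenceInjective := by
  obtain ⟨T, u, v, hT, -, -, hodd, rfl⟩ := hG
  exact incidenceInjective_addEdge hT (by simpa [Nat.odd_add_one] using hodd)

theorem IsTreePlusSelfLoop.incidenceInjective {G : Multigraph V} (hG : G.IsTreePlusSelfLoop) :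
    G.IncidenceInjective := by
  obtain ⟨T, r, hT, rfl⟩ := hG
  exact incidenceInjective_addEdge hT (by simp)

/-- Two finite families of edge weights with the same total weights at the nodes are equal. -/
theorem IncidenceInjective.eq {G : Multigraph V} (hG : G.IncidenceInjective)
    {x y : V → V → ℝ≥0∞} (hx : ∀ i j, x i j = x j i) (hy : ∀ i j, y i j = y j i)
    (hxG : ∀ i j, x i j ≠ 0 → G.Adj i j) (hyG : ∀ i j, y i j ≠ 0 → G.Adj i j)
    (hrow : ∀ i, ∑ j, x i j + x i i = ∑ j, y i j + y i i)
    (hfin : ∀ i, ∑ j, x i j + x i i ≠ ⊤) (i j : V) : x i j = y i j := by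
  have hxt : ∀ i j, x i j ≠ ⊤ := fun i j =>
    ENNReal.sum_ne_top.1 (ENNReal.add_ne_top.1 (hfin i)).1 j (Finset.mem_univ j)
  have hyt : ∀ i j, y i j ≠ ⊤ := fun i j =>
    ENNReal.sum_ne_top.1 (ENNReal.add_ne_top.1 (hrow i ▸ hfin i)).1 j (Finset.mem_univ j)
  have h := hG (fun i j => (x i j).toReal - (y i j).toReal)
    (fun i j => by simp only [hx i j, hy i j])
    (fun i j hij => by
      by_contra hadj
      have h1 : x i j = 0 := not_not.1 (mt (hxG i j) hadj)
      have h2 : y i j = 0 := not_not.1 (mt (hyG i j) hadj)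
      simp [h1, h2] at hij)
    (fun i => by
      have h1 := congrArg ENNReal.toReal (hrow i)
      rw [ENNReal.toReal_add (ENNReal.add_ne_top.1 (hfin i)).1 (hxt i i),
        ENNReal.toReal_add (ENNReal.add_ne_top.1 (hrow i ▸ hfin i)).1 (hyt i i),
        ENNReal.toReal_sum fun j _ => hxt i j, ENNReal.toReal_sum fun j _ => hyt i j] at h1
      rw [Finset.sum_sub_distrib]
      linarith) i j
  exact (ENNReal.toReal_eq_toReal_iff' (hxt i j) (hyt i j)).1 (sub_eq_zero.1 h)

end Incidence

variable {V : Type*}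

instance (G : Multigraph V) : Nonempty G.Buffer := ⟨⟨[], List.Pairwise.nil⟩⟩

instance (G : Multigraph V) (V₁ : Set V) : Nonempty (G.BipBuffer V₁) :=
  ⟨⟨([], []), rfl, by simp⟩⟩

theorem count_eraseIdx_add {α : Type*} [BEq α] [LawfulBEq α] (l : List α) (p : Fin l.length)
    (k : α) : (l.eraseIdx p).count k + (if l.get p == k then 1 else 0) = l.count k := by
  have h := (List.getElem_cons_eraseIdx_perm p.2).count_eq k
  rwa [List.count_cons] at h

/-! ### Conservation in the general matching model -/

section General

variable {G : Multigraph V}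

open scoped Classical in
/-- The number of stored `k`-items grows by the number of incoming `k`-items minus the number of
matched ones. -/
theorem count_add_of_mem_support_step (Φ : G.Policy) (w : G.Buffer) (i k : V)
    (x : G.Buffer × Option V) (hx : x ∈ (step Φ w i).support) :
    x.1.1.count k + ((if x.2 = some k then 1 else 0) + if i = k ∧ x.2 ≠ none then 1 else 0) =
      w.1.count k + if i = k then 1 else 0 := by
  rw [step] at hx
  split_ifs at hx with h
  · rw [PMF.mem_support_map_iff] at hx
    obtain ⟨p, -, rfl⟩ := hx
    have hp := count_eraseIdx_add w.1 p.1 k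
    simp only [beq_iff_eq] at hp
    simp only [Option.some.injEq, ne_eq, reduceCtorEq, not_false_eq_true, and_true]
    omega
  · rw [PMF.mem_support_pure_iff] at hx
    subst hx
    simp [List.count_append, List.count_singleton]

theorem adj_of_mem_support_step (Φ : G.Policy) (w : G.Buffer) (i j : V)
    (x : G.Buffer × Option V) (hx : x ∈ (step Φ w i).support) (hj : x.2 = some j) :
    G.Adj i j := by
  rw [step] at hx
  split_ifs at hx with h
  · rw [PMF.mem_support_map_iff] at hx
    obtain ⟨p, -, rfl⟩ := hx
    simp only [Option.some.injEq] at hj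
    exact hj ▸ p.2
  · rw [PMF.mem_support_pure_iff] at hx
    subst hx
    simp at hj

theorem matchProb_eq_zero (Φ : G.Policy) (p : PMF V) {i j : V} (hij : ¬ G.Adj i j) :
    matchProb Φ p i j = 0 := by
  rw [matchProb, ENNReal.tsum_eq_zero]
  intro w
  rw [mul_eq_zero]
  right
  rw [PMF.apply_eq_zero_iff, PMF.mem_support_map_iff]
  rintro ⟨x, hx, hxj⟩
  exact hij (adj_of_mem_support_step Φ w i j x hx hxj)

open scoped Classical in
theorem map_snd_step_apply (Φ : G.Policy) (w : G.Buffer) (i j : V) :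
    ((step Φ w i).map Prod.snd) (some j) =
      ∑' x, step Φ w i x * ((if x.2 = some j then 1 else 0 : ℕ) : ℝ≥0∞) := by
  rw [← PMF.tsum_map_mul (step Φ w i) Prod.snd
    fun o => ((if o = some j then 1 else 0 : ℕ) : ℝ≥0∞), tsum_eq_single (some j)]
  · simp
  · intro o ho
    simp [ho]

open scoped Classical in
theorem sum_map_snd_step_apply [Fintype V] (Φ : G.Policy) (w : G.Buffer) (i : V) :
    ∑ j, ((step Φ w i).map Prod.snd) (some j) =
      ∑' x, step Φ w i x * ((if x.2 ≠ none then 1 else 0 : ℕ) : ℝ≥0∞) := by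
  rw [← PMF.tsum_map_mul (step Φ w i) Prod.snd
    fun o => ((if o ≠ none then 1 else 0 : ℕ) : ℝ≥0∞), tsum_fintype, Fintype.sum_option]
  simp

/-- All the incoming items of a class get matched in the stationary regime. -/
theorem sum_mul_matchProb [Fintype V] (Φ : G.Policy) (p : PMF V) (hΦ : Stable Φ p) (k : V) :
    ∑ j, p k * matchProb Φ p k j + ∑ i, p i * matchProb Φ p i k = p k := by
  classical
  obtain ⟨π, hπ, hst⟩ := MarkovChain.PositiveRecurrent.exists_stationaryDist_eq hΦ
  have hmp : ∀ i j, matchProb Φ p i j = ∑' w, π w * ((step Φ w i).map Prod.snd) (some j) := by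
    intro i j
    rw [matchProb, hst]
  -- The kernel is enriched with the class of the arrival and of its match, from which the flows of
  -- `k`-items are read.
  set K : G.Buffer → PMF (G.Buffer × (V × Option V)) := fun w =>
    p.bind fun i => (step Φ w i).map fun x => (x.1, (i, x.2)) with hK
  have hE : ∀ (w : G.Buffer) (g : V × Option V → ℕ), ∑' y, K w y * (g y.2 : ℝ≥0∞) =
      ∑' i, p i * ∑' x, step Φ w i x * (g (i, x.2) : ℝ≥0∞) := by
    intro w g
    rw [hK, PMF.tsum_bind_mul]
    simp_rw [PMF.tsum_map_mul]
  have hsupp : ∀ w, ∀ y ∈ (K w).support, ∃ x ∈ (step Φ w y.2.1).support, x = (y.1, y.2.2) := by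
    intro w y hy
    rw [hK, PMF.mem_support_bind_iff] at hy
    obtain ⟨i, -, hi⟩ := hy
    rw [PMF.mem_support_map_iff] at hi
    obtain ⟨x, hx, rfl⟩ := hi
    exact ⟨x, hx, rfl⟩
  have hbal := MarkovChain.tsum_mul_eq_of_stationary π K
    (by
      conv_rhs => rw [← hπ]
      congr 1
      funext w
      rw [hK, chain, PMF.map_bind]
      simp_rw [PMF.map_comp]
      rfl)
    (fun w => w.1.count k)
    -- Departures of `k`-items, as the stored partner or as the incoming item. An item matched on
    -- arrival counts as both entering and leaving. The bound 2 is reached when a `k`-item meets a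
    -- stored `k`-item.
    (fun o => (if o.2 = some k then 1 else 0) + if o.1 = k ∧ o.2 ≠ none then 1 else 0)
    (fun o => if o.1 = k then 1 else 0) 2
    (fun w y hy => by
      obtain ⟨x, hx, rfl⟩ := hsupp w y hy
      exact count_add_of_mem_support_step Φ w _ k _ hx)
    (fun w y _ => by
      split_ifs <;> omega)
    (fun w y _ => by
      split_ifs <;> omega)
  simp_rw [hE _ fun o => if o.1 = k then 1 else 0] at hbal
  simp_rw [hE _ fun o => (if o.2 = some k then 1 else 0) + if o.1 = k ∧ o.2 ≠ none then 1 else 0]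
    at hbal
  have hin : ∑' w, π w * ∑' i, p i * ∑' x, step Φ w i x *
      ((if i = k then 1 else 0 : ℕ) : ℝ≥0∞) = p k := by
    simp_rw [PMF.tsum_mul_const, tsum_fintype]
    simp
  rw [hin] at hbal
  conv_rhs => rw [← hbal]
  have hsplit : ∀ w, ∑' i, p i * ∑' x, step Φ w i x *
      (((if x.2 = some k then 1 else 0) + if i = k ∧ x.2 ≠ none then 1 else 0 : ℕ) : ℝ≥0∞) =
      p k * ∑ j, ((step Φ w k).map Prod.snd) (some j) +
        ∑ i, p i * ((step Φ w i).map Prod.snd) (some k) := by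
    intro w
    rw [sum_map_snd_step_apply]
    simp_rw [map_snd_step_apply, Nat.cast_add, mul_add, ENNReal.tsum_add, mul_add, ENNReal.tsum_add,
      tsum_fintype (L := .unconditional V)]
    rw [add_comm]
    congr 1
    rw [Finset.sum_eq_single k]
    · simp
    · intro i _ hi
      simp [hi]
    · simp
  simp_rw [hsplit, mul_add, ENNReal.tsum_add, Finset.mul_sum, hmp]
  rw [Summable.tsum_finsetSum fun _ _ => ENNReal.summable,
    Summable.tsum_finsetSum fun _ _ => ENNReal.summable]
  simp_rw [← ENNReal.tsum_mul_left]
  congr 1 <;>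
    exact Finset.sum_congr rfl fun i _ => tsum_congr fun w => by ring

theorem matchingRate_comm (Φ : G.Policy) (p : PMF V) (i j : V) :
    matchingRate Φ p i j = matchingRate Φ p j i := by
  by_cases h : i = j
  · rw [h]
  · rw [matchingRate, matchingRate, if_neg h, if_neg (Ne.symm h), add_comm]

theorem adj_of_matchingRate_ne_zero (Φ : G.Policy) (p : PMF V) {i j : V}
    (h : matchingRate Φ p i j ≠ 0) : G.Adj i j := by
  by_contra hij
  refine h ?_
  rw [matchingRate, matchProb_eq_zero Φ p hij, matchProb_eq_zero Φ p (mt (G.symm _ _) hij)]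
  simp

/-- The diagonal rate contains `p k * matchProb Φ p k k` only once, while such a match removes two
`k`-items; the extra summand restores the second one. -/
theorem sum_matchingRate [Fintype V] (Φ : G.Policy) (p : PMF V) (hΦ : Stable Φ p) (k : V) :
    ∑ j, matchingRate Φ p k j + matchingRate Φ p k k = p k := by
  classical
  conv_rhs => rw [← sum_mul_matchProb Φ p hΦ k]
  simp_rw [matchingRate, Finset.sum_add_distrib]
  rw [if_pos trivial, add_zero, add_assoc]
  congr 1
  rw [← Finset.add_sum_erase _ _ (Finset.mem_univ k), ← Finset.add_sum_erase _ _ (Finset.mem_univ k),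
    if_pos rfl, zero_add, add_comm]
  congr 1
  exact Finset.sum_congr rfl fun j hj => if_neg (Finset.ne_of_mem_erase hj).symm

theorem IncidenceInjective.generalPolicyInvariant [Fintype V] [Nonempty V]
    (hG : G.IncidenceInjective) : G.GeneralPolicyInvariant := by
  intro μ hμ Φ Φ' hΦ hΦ'
  refine hG.eq (matchingRate_comm Φ _) (matchingRate_comm Φ' _)
    (fun _ _ => adj_of_matchingRate_ne_zero Φ _) (fun _ _ => adj_of_matchingRate_ne_zero Φ' _)
    (fun k => ?_) fun k => ?_
  · rw [sum_matchingRate Φ _ hΦ, sum_matchingRate Φ' _ hΦ']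
  · rw [sum_matchingRate Φ _ hΦ]
    exact PMF.apply_ne_top _ _

end General
-- Conservation in the extended bipartite model
theorem sum_count_mk {α β : Type*} [BEq α] [LawfulBEq α] [BEq β] [LawfulBEq β]
    [Fintype β] (l : List (α × β)) (k : α) :
    ∑ b, l.count (k, b) = (l.map Prod.fst).count k := by
  classical
  induction l with
  | nil => simp
  | cons c l ih =>
    obtain ⟨a, b⟩ := c
    simp only [List.count_cons, List.map_cons, Finset.sum_add_distrib, ih, beq_iff_eq,
      Prod.mk.injEq]
    by_cases h : a = k <;> simp [h]

theorem sum_count_mk' {α β : Type*} [BEq α] [LawfulBEq α] [BEq β] [LawfulBEq β]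
    [Fintype α] (l : List (α × β)) (k : β) :
    ∑ a, l.count (a, k) = (l.map Prod.snd).count k := by
  classical
  induction l with
  | nil => simp
  | cons c l ih =>
    obtain ⟨a, b⟩ := c
    simp only [List.count_cons, List.map_cons, Finset.sum_add_distrib, ih, beq_iff_eq,
      Prod.mk.injEq]
    by_cases h : b = k <;> simp [h]

section Bipartite

variable {G : Multigraph V} {V₁ : Set V}

/-- At most two matchings are performed at an arrival, and they match compatible items. -/
theorem bipStep_support (Φ : G.BipPolicy V₁) (w : G.BipBuffer V₁) (i : V₁) (j : ↥(V₁ᶜ))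
    (x : G.BipBuffer V₁ × List (V₁ × ↥(V₁ᶜ))) (hx : x ∈ (bipStep Φ w i j).support) :
    x.2.length ≤ 2 ∧ ∀ c ∈ x.2, G.Adj c.1 c.2 := by
  rw [bipStep] at hx
  split_ifs at hx with hj hi hi hij
  · rw [PMF.mem_support_bind_iff] at hx
    obtain ⟨p, -, hx⟩ := hx
    rw [PMF.mem_support_map_iff] at hx
    obtain ⟨q, -, rfl⟩ := hx
    simpa using ⟨p.2, q.2⟩
  · rw [PMF.mem_support_bind_iff] at hx
    obtain ⟨p, -, hx⟩ := hx
    rw [PMF.mem_support_pure_iff] at hx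
    subst hx
    simpa using p.2
  · rw [PMF.mem_support_map_iff] at hx
    obtain ⟨q, -, rfl⟩ := hx
    simpa using q.2
  · rw [PMF.mem_support_pure_iff] at hx
    subst hx
    simpa using hij
  · rw [PMF.mem_support_pure_iff] at hx
    subst hx
    simp

-- An item matched on arrival counts both as an arrival and in the list of matchings, so the balance
-- has one form for all five outcomes of an arrival.
open scoped Classical in
theorem count_left_of_mem_support_bipStep (Φ : G.BipPolicy V₁) (w : G.BipBuffer V₁) (i : V₁)
    (j : ↥(V₁ᶜ)) (k : V₁) (x : G.BipBuffer V₁ × List (V₁ × ↥(V₁ᶜ)))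
    (hx : x ∈ (bipStep Φ w i j).support) :
    x.1.1.1.count k + (x.2.map Prod.fst).count k = w.1.1.count k + if i = k then 1 else 0 := by
  rw [bipStep] at hx
  split_ifs at hx with hj hi hi hij
  · rw [PMF.mem_support_bind_iff] at hx
    obtain ⟨p, -, hx⟩ := hx
    rw [PMF.mem_support_map_iff] at hx
    obtain ⟨q, -, rfl⟩ := hx
    have hp := count_eraseIdx_add w.1.1 p.1 k
    simp only [beq_iff_eq] at hp
    simp only [List.map_cons, List.map_nil, List.count_cons, List.count_nil, beq_iff_eq]
    omega
  · rw [PMF.mem_support_bind_iff] at hx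
    obtain ⟨p, -, hx⟩ := hx
    rw [PMF.mem_support_pure_iff] at hx
    subst hx
    have hp := count_eraseIdx_add w.1.1 p.1 k
    simp only [beq_iff_eq] at hp
    simp only [List.map_cons, List.map_nil, List.count_append, List.count_cons, List.count_nil,
      beq_iff_eq]
    omega
  · rw [PMF.mem_support_map_iff] at hx
    obtain ⟨q, -, rfl⟩ := hx
    simp [List.count_cons, Subtype.ext_iff]
  · rw [PMF.mem_support_pure_iff] at hx
    subst hx
    simp [List.count_cons, Subtype.ext_iff]
  · rw [PMF.mem_support_pure_iff] at hx
    subst hx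
    simp [List.count_append, List.count_cons, Subtype.ext_iff]

open scoped Classical in
theorem count_right_of_mem_support_bipStep (Φ : G.BipPolicy V₁) (w : G.BipBuffer V₁) (i : V₁)
    (j : ↥(V₁ᶜ)) (k : ↥(V₁ᶜ)) (x : G.BipBuffer V₁ × List (V₁ × ↥(V₁ᶜ)))
    (hx : x ∈ (bipStep Φ w i j).support) :
    x.1.1.2.count k + (x.2.map Prod.snd).count k = w.1.2.count k + if j = k then 1 else 0 := by
  rw [bipStep] at hx
  split_ifs at hx with hj hi hi hij
  · rw [PMF.mem_support_bind_iff] at hx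
    obtain ⟨p, -, hx⟩ := hx
    rw [PMF.mem_support_map_iff] at hx
    obtain ⟨q, -, rfl⟩ := hx
    have hq := count_eraseIdx_add w.1.2 q.1 k
    simp only [beq_iff_eq] at hq
    simp only [List.map_cons, List.map_nil, List.count_cons, List.count_nil, beq_iff_eq]
    omega
  · rw [PMF.mem_support_bind_iff] at hx
    obtain ⟨p, -, hx⟩ := hx
    rw [PMF.mem_support_pure_iff] at hx
    subst hx
    simp [List.count_cons, Subtype.ext_iff]
  · rw [PMF.mem_support_map_iff] at hx
    obtain ⟨q, -, rfl⟩ := hx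
    have hq := count_eraseIdx_add w.1.2 q.1 k
    simp only [beq_iff_eq] at hq
    simp only [List.map_cons, List.map_nil, List.count_append, List.count_cons, List.count_nil,
      beq_iff_eq]
    omega
  · rw [PMF.mem_support_pure_iff] at hx
    subst hx
    simp [List.count_cons, Subtype.ext_iff]
  · rw [PMF.mem_support_pure_iff] at hx
    subst hx
    simp [List.count_append, List.count_cons, Subtype.ext_iff]

theorem adj_of_bipMatchingRate_ne_zero (Φ : G.BipPolicy V₁) (p : PMF (V₁ × ↥(V₁ᶜ))) {i : V₁}
    {j : ↥(V₁ᶜ)} (h : bipMatchingRate Φ p i j ≠ 0) : G.Adj i j := by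
  classical
  by_contra hij
  refine h ?_
  rw [bipMatchingRate, ENNReal.tsum_eq_zero]
  intro w
  rw [mul_eq_zero, ENNReal.tsum_eq_zero]
  refine Or.inr fun c => ?_
  rw [mul_eq_zero, ENNReal.tsum_eq_zero]
  refine Or.inr fun x => ?_
  rw [mul_eq_zero]
  by_cases hx : x ∈ (bipStep Φ w c.1 c.2).support
  · right
    rw [Nat.cast_eq_zero, List.count_eq_zero]
    exact fun hc => hij ((bipStep_support Φ w _ _ x hx).2 _ hc)
  · left
    rwa [PMF.mem_support_iff, not_not] at hx

/-- Rate conservation in the bipartite model, for a count `f` of stored items that grows by `b` at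
each arrival and decreases by `a` with the matchings. -/
theorem bip_tsum_eq_of_balance (Φ : G.BipPolicy V₁) (p : PMF (V₁ × ↥(V₁ᶜ)))
    {π : PMF (G.BipBuffer V₁)} (hπ : π.bind (bipChain Φ p) = π) (f : G.BipBuffer V₁ → ℕ)
    (a : List (V₁ × ↥(V₁ᶜ)) → ℕ) (b : V₁ × ↥(V₁ᶜ) → ℕ) (ha : ∀ l, a l ≤ l.length)
    (hb : ∀ c, b c ≤ 2)
    (h : ∀ w c, ∀ x ∈ (bipStep Φ w c.1 c.2).support, f x.1 + a x.2 = f w + b c) :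
    ∑' w, π w * ∑' c, p c * ∑' x, bipStep Φ w c.1 c.2 x * (a x.2 : ℝ≥0∞) =
      ∑' c, p c * (b c : ℝ≥0∞) := by
  set K : G.BipBuffer V₁ → PMF (G.BipBuffer V₁ × ((V₁ × ↥(V₁ᶜ)) × List (V₁ × ↥(V₁ᶜ)))) := fun w =>
    p.bind fun c => (bipStep Φ w c.1 c.2).map fun x => (x.1, (c, x.2)) with hK
  have hE : ∀ (w : G.BipBuffer V₁) (g : (V₁ × ↥(V₁ᶜ)) × List (V₁ × ↥(V₁ᶜ)) → ℕ),
      ∑' y, K w y * (g y.2 : ℝ≥0∞) =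
        ∑' c, p c * ∑' x, bipStep Φ w c.1 c.2 x * (g (c, x.2) : ℝ≥0∞) := by
    intro w g
    rw [hK, PMF.tsum_bind_mul]
    simp_rw [PMF.tsum_map_mul]
  have hsupp : ∀ w, ∀ y ∈ (K w).support,
      ∃ x ∈ (bipStep Φ w y.2.1.1 y.2.1.2).support, x = (y.1, y.2.2) := by
    intro w y hy
    rw [hK, PMF.mem_support_bind_iff] at hy
    obtain ⟨i, -, hi⟩ := hy
    rw [PMF.mem_support_map_iff] at hi
    obtain ⟨x, hx, rfl⟩ := hi
    exact ⟨x, hx, rfl⟩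
  have hbal := MarkovChain.tsum_mul_eq_of_stationary π K
    (by
      conv_rhs => rw [← hπ]
      congr 1
      funext w
      rw [hK, bipChain, PMF.map_bind]
      simp_rw [PMF.map_comp]
      rfl)
    f (fun o => a o.2) (fun o => b o.1) 2
    (fun w y hy => by
      obtain ⟨x, hx, rfl⟩ := hsupp w y hy
      exact h w _ _ hx)
    (fun w y hy => by
      obtain ⟨x, hx, rfl⟩ := hsupp w y hy
      exact (ha _).trans (bipStep_support Φ w _ _ _ hx).1)
    (fun w y _ => hb _)
  simp_rw [hE _ fun o => a o.2, hE _ fun o => b o.1, PMF.tsum_mul_const] at hbal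
  exact hbal

theorem sum_bipMatchingRate_left [Fintype ↥(V₁ᶜ)] (Φ : G.BipPolicy V₁) (p : PMF (V₁ × ↥(V₁ᶜ)))
    (hΦ : BipStable Φ p) (i : V₁) : ∑ j, bipMatchingRate Φ p i j = p.map Prod.fst i := by
  classical
  obtain ⟨π, hπ, hst⟩ := MarkovChain.PositiveRecurrent.exists_stationaryDist_eq hΦ
  have h := bip_tsum_eq_of_balance Φ p hπ (fun w => w.1.1.count i)
    (fun l => (l.map Prod.fst).count i) (fun c => if c.1 = i then 1 else 0)
    (fun l => List.count_le_length.trans (List.length_map _).le)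
    (fun c => by split_ifs <;> omega)
    fun w c x hx => count_left_of_mem_support_bipStep Φ w _ _ i x hx
  simp_rw [← sum_count_mk, Nat.cast_sum, Finset.mul_sum,
    Summable.tsum_finsetSum fun _ _ => ENNReal.summable, Finset.mul_sum,
    Summable.tsum_finsetSum fun _ _ => ENNReal.summable, Finset.mul_sum,
    Summable.tsum_finsetSum fun _ _ => ENNReal.summable] at h
  simp_rw [bipMatchingRate, hst]
  convert h using 1
  rw [PMF.map_apply]
  refine tsum_congr fun c => ?_
  by_cases hc : c.1 = i
  · simp [hc]
  · simp [hc, Ne.symm hc]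

theorem sum_bipMatchingRate_right [Fintype V₁] (Φ : G.BipPolicy V₁) (p : PMF (V₁ × ↥(V₁ᶜ)))
    (hΦ : BipStable Φ p) (j : ↥(V₁ᶜ)) : ∑ i, bipMatchingRate Φ p i j = p.map Prod.snd j := by
  classical
  obtain ⟨π, hπ, hst⟩ := MarkovChain.PositiveRecurrent.exists_stationaryDist_eq hΦ
  have h := bip_tsum_eq_of_balance Φ p hπ (fun w => w.1.2.count j)
    (fun l => (l.map Prod.snd).count j) (fun c => if c.2 = j then 1 else 0)
    (fun l => List.count_le_length.trans (List.length_map _).le)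
    (fun c => by split_ifs <;> omega)
    fun w c x hx => count_right_of_mem_support_bipStep Φ w _ _ j x hx
  simp_rw [← sum_count_mk', Nat.cast_sum, Finset.mul_sum,
    Summable.tsum_finsetSum fun _ _ => ENNReal.summable, Finset.mul_sum,
    Summable.tsum_finsetSum fun _ _ => ENNReal.summable, Finset.mul_sum,
    Summable.tsum_finsetSum fun _ _ => ENNReal.summable] at h
  simp_rw [bipMatchingRate, hst]
  convert h using 1
  rw [PMF.map_apply]
  refine tsum_congr fun c => ?_
  by_cases hc : c.2 = j
  · simp [hc]
  · simp [hc, Ne.symm hc]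

open scoped Classical in
/-- The symmetric edge weights given by weights on `V₁ × V₁ᶜ`. -/
def symmetrize (B : V₁ → ↥(V₁ᶜ) → ℝ≥0∞) (a b : V) : ℝ≥0∞ :=
  if h : a ∈ V₁ ∧ b ∈ V₁ᶜ then B ⟨a, h.1⟩ ⟨b, h.2⟩
  else if h : b ∈ V₁ ∧ a ∈ V₁ᶜ then B ⟨b, h.1⟩ ⟨a, h.2⟩ else 0

theorem symmetrize_coe (B : V₁ → ↥(V₁ᶜ) → ℝ≥0∞) (i : V₁) (j : ↥(V₁ᶜ)) :
    symmetrize B i j = B i j := by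
  simp only [symmetrize, i.2, j.2, and_self, dite_true, Subtype.coe_eta]

theorem symmetrize_comm (B : V₁ → ↥(V₁ᶜ) → ℝ≥0∞) (a b : V) :
    symmetrize B a b = symmetrize B b a := by
  by_cases ha : a ∈ V₁ <;> by_cases hb : b ∈ V₁ <;> simp [symmetrize, ha, hb]

theorem symmetrize_eq_zero_of_iff (B : V₁ → ↥(V₁ᶜ) → ℝ≥0∞) {a b : V} (h : a ∈ V₁ ↔ b ∈ V₁) :
    symmetrize B a b = 0 := by
  by_cases hb : b ∈ V₁ <;> simp [symmetrize, h, hb]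

theorem sum_symmetrize_left [Fintype V] [Fintype ↥(V₁ᶜ)] (B : V₁ → ↥(V₁ᶜ) → ℝ≥0∞) (i : V₁) :
    ∑ b, symmetrize B i b + symmetrize B i i = ∑ j, B i j := by
  classical
  rw [symmetrize_eq_zero_of_iff B Iff.rfl, add_zero,
    ← Fintype.sum_subtype_add_sum_subtype (· ∈ V₁ᶜ)]
  simp_rw [← symmetrize_coe B]
  rw [Finset.sum_eq_zero (s := (Finset.univ : Finset {x // ¬ x ∈ V₁ᶜ})), add_zero]
  · exact Finset.sum_congr (by ext; simp) fun _ _ => rfl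
  · intro b _
    exact symmetrize_eq_zero_of_iff B ⟨fun _ => not_not.1 b.2, fun _ => i.2⟩

theorem sum_symmetrize_right [Fintype V] [Fintype V₁] (B : V₁ → ↥(V₁ᶜ) → ℝ≥0∞) (j : ↥(V₁ᶜ)) :
    ∑ b, symmetrize B j b + symmetrize B j j = ∑ i, B i j := by
  classical
  rw [symmetrize_eq_zero_of_iff B Iff.rfl, add_zero,
    ← Fintype.sum_subtype_add_sum_subtype (· ∈ V₁)]
  simp_rw [← symmetrize_coe B]
  rw [Finset.sum_eq_zero (s := (Finset.univ : Finset {x // ¬ x ∈ V₁})), add_zero]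
  · exact Finset.sum_congr (by ext; simp) fun _ _ => symmetrize_comm B _ _
  · intro b _
    exact symmetrize_eq_zero_of_iff B ⟨fun h => absurd h j.2, fun h => absurd h b.2⟩

theorem adj_of_symmetrize_ne_zero {B : V₁ → ↥(V₁ᶜ) → ℝ≥0∞}
    (hB : ∀ i j, B i j ≠ 0 → G.Adj i j) (a b : V) (h : symmetrize B a b ≠ 0) : G.Adj a b := by
  rw [symmetrize] at h
  split_ifs at h with h1 h2
  · exact hB _ _ h
  · exact G.symm _ _ (hB _ _ h)
  · exact absurd rfl h

/-- Symmetrized, the bipartite rates become edge weights on `G` whose totals at the nodes are the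
marginals of `p`, whatever the policy. -/
theorem IncidenceInjective.bipPolicyInvariant [Fintype V] (hG : G.IncidenceInjective) :
    G.BipPolicyInvariant V₁ := by
  classical
  intro μ _ p _ _ _ Φ Φ' hΦ hΦ' i j
  have hrow : ∀ (Ψ : G.BipPolicy V₁), BipStable Ψ p → ∀ a,
      ∑ b, symmetrize (bipMatchingRate Ψ p) a b + symmetrize (bipMatchingRate Ψ p) a a =
        if h : a ∈ V₁ then p.map Prod.fst ⟨a, h⟩ else p.map Prod.snd ⟨a, h⟩ := by
    intro Ψ hΨ a
    split_ifs with h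
    · rw [← sum_bipMatchingRate_left Ψ p hΨ]
      exact sum_symmetrize_left _ ⟨a, h⟩
    · rw [← sum_bipMatchingRate_right Ψ p hΨ]
      exact sum_symmetrize_right _ ⟨a, h⟩
  have h := hG.eq (symmetrize_comm (bipMatchingRate Φ p)) (symmetrize_comm (bipMatchingRate Φ' p))
    (adj_of_symmetrize_ne_zero fun _ _ => adj_of_bipMatchingRate_ne_zero Φ p)
    (adj_of_symmetrize_ne_zero fun _ _ => adj_of_bipMatchingRate_ne_zero Φ' p)
    (fun a => by rw [hrow Φ hΦ, hrow Φ' hΦ'])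
    (fun a => by
      rw [hrow Φ hΦ]
      split_ifs <;> exact PMF.apply_ne_top _ _) i j
  rwa [symmetrize_coe, symmetrize_coe] at h

end Bipartite

theorem IncidenceInjective.policyInvariant [Fintype V] [Nonempty V] {G : Multigraph V}
    (hG : G.IncidenceInjective) : G.PolicyInvariant :=
  ⟨fun _ => hG.generalPolicyInvariant, fun _ _ => hG.bipPolicyInvariant⟩

end Multigraph

end

theorem mainTheorem4 {V : Type*} [Fintype V] [Nontrivial V] (G : Multigraph V)
    (hG : G.IsOddCycle ∨ G.IsTree ∨ G.IsTreePlusOddEdge ∨ G.IsTreePlusSelfLoop) :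
    G.PolicyInvariant := by
  rcases hG with h | h | h | h <;> exact h.incidenceInjective.policyInvariant
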